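/- Let $k\ge 3$ and $n\ge 1$, and let $C_k=(V,E)$ be the cycle graph on $k$ vertices. Choose an arbitrary orientation of every edge. Each oriented edge $e=(x,y)$ acts on the finite words over $V$ by $e(\emptyset)=\emptyset$ and, for every word $w$, $$e(xw)=y\,e(w),\qquad e(yw)=xw,\qquad e(zw)=zw\quad (z\in V\setminus\{x,y\}).$$ These transformations are length-preserving permutations, and they generate the graph automaton group of $C_k$. Let $\Gamma_n^{C_k}$ be its $n$-th Schreier graph, considered as a simple (undirected, unlabeled) graph: its vertex set is $V^n$, and two distinct words are adjacent if and only if one is the image of the other under some oriented edge $e$. For an automorphism $\varphi$ of $C_k$ put $\varphi_n(v_1\cdots v_n)=\varphi(v_1)\cdots\varphi(v_n)$. Then $\varphi\mapsto\varphi_n$ is a group isomorphism from $\mathrm{Aut}(C_k)$ onto $\mathrm{Aut}(\Gamma_n^{C_k})$. In particular every automorphism of $\Gamma_n^{C_k}$ is induced letterwise by an automorphism of $C_k$, and $$\mathrm{Aut}(\Gamma_n^{C_k})\cong \mathrm{Aut}(C_k)\cong D_{2k},$$ where $D_{2k}$ is the dihedral group with $2k$ elements. -/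

import Mathlib

/-- An automaton with set of states `S` and alphabet `X`: in the state `s`, reading the letter `x`,
it outputs the letter `out s x` and moves to the state `restr s x`. -/
structure MealyAutomaton (S X : Type*) where
  restr : S → X → S
  out : S → X → X

namespace MealyAutomaton

variable {S X : Type*}

/-- The transformation of the set `X^*` of finite words that a state `s` defines:
`x w ↦ out s x · (restr s x)(w)`. -/
def act (A : MealyAutomaton S X) : S → List X → List X
  | _, [] => []
  | s, x :: w => A.out s x :: A.act (A.restr s x) w

/-- Every state acts on the alphabet by a permutation. -/
def Invertible (A : MealyAutomaton S X) : Prop :=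
  ∀ s, Function.Bijective (A.out s)

theorem length_act (A : MealyAutomaton S X) (s : S) (w : List X) :
    (A.act s w).length = w.length := by
  induction w generalizing s with
  | nil => rfl
  | cons x w ih => simp [act, ih]

theorem bijective_act (A : MealyAutomaton S X) (hA : A.Invertible) (s : S) :
    Function.Bijective (A.act s) := by
  constructor
  · intro u
    induction u generalizing s with
    | nil =>
      intro v h
      cases v with
      | nil => rfl
      | cons y v => simp [act] at h
    | cons x u ih =>
      intro v h
      cases v with
      | nil => simp [act] at h
      | cons y v =>
        simp only [act, List.cons.injEq] at h
        obtain rfl := (hA s).1 h.1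
        rw [ih _ h.2]
  · intro v
    induction v generalizing s with
    | nil => exact ⟨[], rfl⟩
    | cons y v ih =>
      obtain ⟨x, rfl⟩ := (hA s).2 y
      obtain ⟨u, rfl⟩ := ih (A.restr s x)
      exact ⟨x :: u, rfl⟩

/-- The transformation of `X^*` defined by a state of an invertible automaton, as a permutation. -/
noncomputable def statePerm (A : MealyAutomaton S X) (hA : A.Invertible) (s : S) :
    Equiv.Perm (List X) :=
  Equiv.ofBijective (A.act s) (A.bijective_act hA s)

/-- The automaton group: the group of transformations of `X^*` generated by the states. -/
def group (A : MealyAutomaton S X) (hA : A.Invertible) : Subgroup (Equiv.Perm (List X)) :=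
  Subgroup.closure (Set.range (A.statePerm hA))

/-- The states, as elements of the automaton group. -/
noncomputable def gen (A : MealyAutomaton S X) (hA : A.Invertible) (s : S) : A.group hA :=
  ⟨A.statePerm hA s, Subgroup.subset_closure ⟨s, rfl⟩⟩

theorem length_apply (A : MealyAutomaton S X) (hA : A.Invertible) {g : Equiv.Perm (List X)}
    (hg : g ∈ A.group hA) : ∀ w : List X, (g w).length = w.length := by
  induction hg using Subgroup.closure_induction with
  | mem g hg =>
    obtain ⟨s, rfl⟩ := hg
    exact fun w => A.length_act s w
  | one => exact fun _ => rfl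
  | mul g h _ _ hg hh => exact fun w => (hg (h w)).trans (hh w)
  | inv g _ hg =>
    intro w
    have h := hg (g⁻¹ w)
    rw [show g (g⁻¹ w) = w from Equiv.apply_symm_apply g w] at h
    exact h.symm

/-- The action of the automaton group on the set `X^n` of words of length `n`. -/
instance instMulActionVector (A : MealyAutomaton S X) (hA : A.Invertible) (n : ℕ) :
    MulAction (A.group hA) (List.Vector X n) where
  smul g w := ⟨g.1 w.1, (A.length_apply hA g.2 w.1).trans w.2⟩
  one_smul _ := rfl
  mul_smul _ _ _ := rfl

end MealyAutomaton

/-- The (undirected, unlabeled, simple) Schreier graph of the action of a group `𝒢` on a set `M`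
with respect to the elements of `T` and their inverses: two distinct points are adjacent if and
only if one is mapped to the other by some `t` in `T` or by the inverse of some `t` in `T`. -/
def schreierGraph {𝒢 : Type*} [Group 𝒢] (T : Set 𝒢) (M : Type*) [MulAction 𝒢 M] :
    SimpleGraph M where
  Adj m m' := m ≠ m' ∧ ∃ t ∈ T, t • m = m' ∨ t⁻¹ • m = m'
  symm := ⟨by
    rintro m m' ⟨hne, t, ht, h | h⟩
    · exact ⟨hne.symm, t, ht, Or.inr (inv_smul_eq_iff.2 h.symm)⟩
    · exact ⟨hne.symm, t, ht, Or.inl (inv_smul_eq_iff.1 h).symm⟩⟩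
  loopless := ⟨fun _ h => h.1 rfl⟩

/-- The `n`-th Schreier graph of the group of an invertible automaton, with vertex set `X^n`. -/
def MealyAutomaton.schreier {S X : Type*} (A : MealyAutomaton S X) (hA : A.Invertible) (n : ℕ) :
    SimpleGraph (List.Vector X n) :=
  schreierGraph (Set.range (A.gen hA)) (List.Vector X n)

/-- A choice of an orientation for every edge of a graph: from the two darts (ordered pairs of
adjacent vertices) of every edge, exactly one is chosen. -/
structure EdgeOrientation {V : Type*} (G : SimpleGraph V) where
  darts : Set G.Dart
  exactly_one : ∀ d : G.Dart, Xor (d ∈ darts) (d.symm ∈ darts)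

/-- The automaton of a graph with oriented edges. The states are the oriented edges and a sink
`none`, the letters are the vertices. The edge `(x, y)` transposes the letters `x` and `y`;
its restriction at `x` is itself, and all its other restrictions are the sink. -/
def graphAutomaton {V : Type*} [DecidableEq V] (G : SimpleGraph V) (o : EdgeOrientation G) :
    MealyAutomaton (Option o.darts) V where
  restr
    | none, _ => none
    | some e, z => if z = e.1.fst then some e else none
  out
    | none, z => z
    | some e, z => if z = e.1.fst then e.1.snd else if z = e.1.snd then e.1.fst else z

theorem graphAutomaton_invertible {V : Type*} [DecidableEq V] (G : SimpleGraph V)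
    (o : EdgeOrientation G) : (graphAutomaton G o).Invertible
  | none => Function.bijective_id
  | some e => (Equiv.swap e.1.fst e.1.snd).bijective

/-- The `n`-th Schreier graph of the graph automaton group of `G`, with vertex set `V^n`. -/
def graphSchreier {V : Type*} [DecidableEq V] (G : SimpleGraph V) (o : EdgeOrientation G) (n : ℕ) :
    SimpleGraph (List.Vector V n) :=
  (graphAutomaton G o).schreier (graphAutomaton_invertible G o) n

/-! An edge of the Schreier graph replaces the first letter x of a word by a neighbor y. It either
keeps the rest of the word (`SuffixAdj`) or applies the edge from x to y to it (`CarryAdj`); the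
orientation plays no role. For each fixed nonempty suffix, the suffix edges form a copy of the
cycle, which contains exactly one word with doubled first letter. At y x s with x ≠ y, a carry edge
coincides with a suffix edge unless it leads to x y s. Hence such words have degree at most three,
while doubled words have degree four. An automorphism therefore preserves the doubled words and,
through them, both kinds of edges (`preserves_adj_of_iso`).

Rigidity follows by induction on the length (`exists_iso_of_preserves_adj`). Erasing the repeated
letter identifies the doubled words with the words one letter shorter, and both adjacencies of the
shorter words can be read off from the longer ones. The induced map is letterwise by induction;
after division by it, all doubled words are fixed. In each cycle the doubled word and one neighbor
are then fixed, hence the whole cycle (`eq_of_fixes_dupHead`).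

The identification with the dihedral group holds because an automorphism of the cycle is determined
by the images of 0 and 1. -/

/-! ### Connected two-regular graphs -/

/-- Every vertex has exactly two neighbors. -/
def SimpleGraph.TwoRegular {V : Type*} (G : SimpleGraph V) : Prop :=
  ∀ x, ∃ a b, a ≠ b ∧ ∀ z, G.Adj x z ↔ z = a ∨ z = b

namespace SimpleGraph

variable {V : Type*} {G : SimpleGraph V}

theorem TwoRegular.eq_or_eq (hG : G.TwoRegular) {x a b c : V} (ha : G.Adj x a) (hb : G.Adj x b)
    (hc : G.Adj x c) (hab : a ≠ b) : c = a ∨ c = b := by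
  obtain ⟨p, q, hpq, h⟩ := hG x
  rw [h] at ha hb hc
  grind

theorem TwoRegular.exists_adj_ne (hG : G.TwoRegular) (x y : V) : ∃ z, G.Adj x z ∧ z ≠ y := by
  obtain ⟨p, q, hpq, h⟩ := hG x
  by_cases hp : p = y
  · exact ⟨q, (h q).2 (Or.inr rfl), fun hq => hpq (hp.trans hq.symm)⟩
  · exact ⟨p, (h p).2 (Or.inl rfl), hp⟩

/-- In a connected graph, a set that contains two adjacent vertices, and that contains all the
neighbors of each of its vertices that has a neighbor in it, contains every vertex. -/
theorem Preconnected.mem_of_propagates (hG : G.Preconnected) {S : Set V}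
    (hS : ∀ y z z', y ∈ S → z ∈ S → G.Adj y z → G.Adj y z' → z' ∈ S) {x y : V} (hx : x ∈ S)
    (hy : y ∈ S) (hxy : G.Adj x y) (v : V) : v ∈ S := by
  -- Membership alone does not propagate along a walk; a neighbor in `S` has to be carried along.
  suffices h : v ∈ S ∧ ∃ u ∈ S, G.Adj v u from h.1
  obtain ⟨p⟩ := hG v x
  induction p with
  | nil => exact ⟨hx, y, hy, hxy⟩
  | cons hadj _ ih =>
    obtain ⟨hv, u, hu, huv⟩ := ih hx hxy
    exact ⟨hS _ _ _ hv hu huv hadj.symm, _, hv, hadj⟩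

/-- An injective endomorphism of a connected two-regular graph that fixes two adjacent vertices
is the identity. -/
theorem TwoRegular.eq_of_fixes_adj (hG : G.TwoRegular) (hc : G.Preconnected) {f : V → V}
    (hf : Function.Injective f) (hadj : ∀ x y, G.Adj x y → G.Adj (f x) (f y)) {x y : V}
    (hx : f x = x) (hy : f y = y) (hxy : G.Adj x y) (v : V) : f v = v := by
  refine hc.mem_of_propagates (S := {v | f v = v}) ?_ hx hy hxy v
  intro a b c ha hb hab hac
  change f a = a at ha
  change f b = b at hb
  change f c = c
  by_cases hbc : c = b
  · rw [hbc, hb]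
  have h1 := hadj _ _ hac
  rw [ha] at h1
  rcases hG.eq_or_eq hab hac h1 (Ne.symm hbc) with h | h
  · exact absurd (hf (h.trans hb.symm)) hbc
  · exact h

end SimpleGraph

/-! ### Words, the two adjacencies and letterwise maps -/

section Words

variable {V : Type*} {G : SimpleGraph V} {n : ℕ}

/-- Two words that differ in the first letter only, by an edge of `G`. -/
def SuffixAdj (G : SimpleGraph V) (a b : List.Vector V (n + 1)) : Prop :=
  G.Adj a.head b.head ∧ a.tail = b.tail

@[simp] theorem suffixAdj_cons {x y : V} {s t : List.Vector V n} :
    SuffixAdj G (x ::ᵥ s) (y ::ᵥ t) ↔ G.Adj x y ∧ s = t := by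
  simp [SuffixAdj]

theorem suffixAdj_map (φ : G ≃g G) (a b : List.Vector V (n + 1)) :
    SuffixAdj G (a.map φ) (b.map φ) ↔ SuffixAdj G a b := by
  obtain ⟨x, s, rfl⟩ := a.exists_eq_cons
  obtain ⟨y, t, rfl⟩ := b.exists_eq_cons
  have h : Function.Injective (List.Vector.map φ : List.Vector V n → _) := by
    intro u v h
    simpa [List.Vector.ext_iff] using h
  simp [φ.map_adj_iff, h.eq_iff]

/-- Doubling of the first letter of a word. -/
def dupHead (a : List.Vector V (n + 1)) : List.Vector V (n + 2) := a.head ::ᵥ a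

theorem dupHead_cons (x : V) (s : List.Vector V n) : dupHead (x ::ᵥ s) = x ::ᵥ x ::ᵥ s := rfl

theorem exists_dupHead_cons_iff (y x : V) (s : List.Vector V n) :
    (∃ w, dupHead w = y ::ᵥ x ::ᵥ s) ↔ x = y := by
  constructor
  · rintro ⟨w, hw⟩
    obtain ⟨v, w, rfl⟩ := w.exists_eq_cons
    rw [dupHead_cons] at hw
    exact (congrArg (fun v => v.tail.head) hw).symm.trans (congrArg List.Vector.head hw)
  · rintro rfl
    exact ⟨x ::ᵥ s, rfl⟩

theorem dupHead_injective : Function.Injective (dupHead : List.Vector V (n + 1) → _) :=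
  fun _ _ h => congrArg List.Vector.tail h

/-- Letterwise application of a graph automorphism, as a permutation of words. -/
def mapPerm (φ : G ≃g G) (n : ℕ) : Equiv.Perm (List.Vector V n) where
  toFun := List.Vector.map φ
  invFun := List.Vector.map φ.symm
  left_inv w := by ext i; simp
  right_inv w := by ext i; simp

@[simp] theorem mapPerm_apply (φ : G ≃g G) (w : List.Vector V n) : mapPerm φ n w = w.map φ := rfl

theorem dupHead_map (φ : V → V) (w : List.Vector V (n + 1)) :
    dupHead (w.map φ) = (dupHead w).map φ := by
  obtain ⟨x, s, rfl⟩ := w.exists_eq_cons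
  simp [dupHead_cons]

/-- An automorphism of the graph of words of length one is induced by one of the alphabet. -/
theorem exists_iso_of_length_one (f : Equiv.Perm (List.Vector V 1))
    (hA : ∀ a b, SuffixAdj G (f a) (f b) ↔ SuffixAdj G a b) :
    ∃ φ : G ≃g G, ∀ w, f w = w.map φ := by
  have hv : ∀ w : List.Vector V 1, w.head ::ᵥ List.Vector.nil = w := by
    intro w
    obtain ⟨x, s, rfl⟩ := w.exists_eq_cons
    rw [s.eq_nil]
    rfl
  have hadj : ∀ a b : List.Vector V 1, SuffixAdj G a b ↔ G.Adj a.head b.head := by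
    intro a b
    rw [← hv a, ← hv b]
    simp
  refine ⟨⟨⟨fun x => (f (x ::ᵥ .nil)).head, fun x => (f.symm (x ::ᵥ .nil)).head, ?_, ?_⟩, ?_⟩, ?_⟩
  · intro x
    simp [hv]
  · intro x
    simp [hv]
  · intro x y
    change G.Adj (f _).head (f _).head ↔ _
    rw [← hadj, hA, hadj]
    simp
  · intro w
    rw [← hv w]
    change _ = List.Vector.map (fun x => (f (x ::ᵥ .nil)).head) _
    rw [List.Vector.map_cons, List.Vector.map_nil]
    exact (hv _).symm

variable [DecidableEq V]

/-- The transformation of words defined by the edge from `x` to `y`. -/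
def carry (x y : V) : ∀ {n : ℕ}, List.Vector V n → List.Vector V n
  | 0, w => w
  | _ + 1, w =>
    if w.head = x then y ::ᵥ carry x y w.tail else if w.head = y then x ::ᵥ w.tail else w

theorem carry_cons (x y z : V) {n : ℕ} (s : List.Vector V n) :
    carry x y (z ::ᵥ s) =
      if z = x then y ::ᵥ carry x y s else if z = y then x ::ᵥ s else z ::ᵥ s := by
  simp [carry]

@[simp] theorem carry_cons_left (x y : V) {n : ℕ} (s : List.Vector V n) :
    carry x y (x ::ᵥ s) = y ::ᵥ carry x y s := by
  simp [carry_cons]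

@[simp] theorem carry_cons_right (x y : V) (h : y ≠ x) {n : ℕ} (s : List.Vector V n) :
    carry x y (y ::ᵥ s) = x ::ᵥ s := by
  simp [carry_cons, h]

theorem carry_cons_of_ne {x y z : V} (hx : z ≠ x) (hy : z ≠ y) {n : ℕ} (s : List.Vector V n) :
    carry x y (z ::ᵥ s) = z ::ᵥ s := by
  simp [carry_cons, hx, hy]

/-- Reversing an edge inverts its transformation, so the Schreier graph cannot see the orientation.
-/
theorem carry_carry {x y : V} (h : x ≠ y) {n : ℕ} (s : List.Vector V n) :
    carry y x (carry x y s) = s := by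
  induction n with
  | zero => rfl
  | succ n ih =>
    obtain ⟨z, s, rfl⟩ := s.exists_eq_cons
    by_cases hx : z = x
    · subst hx; rw [carry_cons_left, carry_cons_left, ih]
    by_cases hy : z = y
    · subst hy; rw [carry_cons_right _ _ hx, carry_cons_right _ _ h]
    · rw [carry_cons_of_ne hx hy, carry_cons_of_ne hy hx]

theorem map_carry (φ : V → V) (hφ : Function.Injective φ) (x y : V) {n : ℕ}
    (s : List.Vector V n) : (carry x y s).map φ = carry (φ x) (φ y) (s.map φ) := by
  induction n with
  | zero => rw [List.Vector.eq_nil s]; rfl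
  | succ n ih =>
    obtain ⟨z, s, rfl⟩ := s.exists_eq_cons
    rw [carry_cons, List.Vector.map_cons, carry_cons]
    simp only [hφ.eq_iff]
    split_ifs <;> simp [ih]

/-- `b` is the image of `a` under an edge that starts at the first letter of `a`. -/
def CarryAdj (G : SimpleGraph V) (a b : List.Vector V (n + 1)) : Prop :=
  G.Adj a.head b.head ∧ b.tail = carry a.head b.head a.tail

@[simp] theorem carryAdj_cons {x y : V} {s t : List.Vector V n} :
    CarryAdj G (x ::ᵥ s) (y ::ᵥ t) ↔ G.Adj x y ∧ t = carry x y s := by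
  simp [CarryAdj]

theorem carryAdj_map (φ : G ≃g G) (a b : List.Vector V (n + 1)) :
    CarryAdj G (a.map φ) (b.map φ) ↔ CarryAdj G a b := by
  obtain ⟨x, s, rfl⟩ := a.exists_eq_cons
  obtain ⟨y, t, rfl⟩ := b.exists_eq_cons
  have h : Function.Injective (List.Vector.map φ : List.Vector V n → _) := by
    intro u v h
    simpa [List.Vector.ext_iff] using h
  simp [φ.map_adj_iff, ← map_carry φ φ.injective, h.eq_iff]

end Words

/-! ### Rigidity under both adjacencies -/

section Rigidity

variable {V : Type*} [DecidableEq V] {G : SimpleGraph V} {n : ℕ}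

/-- At x x s a carry always changes the second letter, so no edge is of both kinds. At y x s with x
≠ y, a neighbor z ≠ x of y gives an edge whose carry stops at once. -/
theorem exists_dupHead_iff (hG : G.TwoRegular) (a : List.Vector V (n + 2)) :
    (∃ w, dupHead w = a) ↔ ∀ b, SuffixAdj G a b → ¬ CarryAdj G a b := by
  obtain ⟨y, a, rfl⟩ := a.exists_eq_cons
  obtain ⟨x, s, rfl⟩ := a.exists_eq_cons
  constructor
  · rintro ⟨w, hw⟩ b hA hB
    obtain ⟨x', s', rfl⟩ := w.exists_eq_cons
    obtain ⟨z, t, rfl⟩ := b.exists_eq_cons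
    rw [← hw, dupHead_cons] at hA hB
    rw [suffixAdj_cons] at hA
    rw [carryAdj_cons, carry_cons_left, ← hA.2] at hB
    exact hA.1.ne (congrArg List.Vector.head hB.2)
  · intro h
    by_cases hyx : x = y
    · exact ⟨x ::ᵥ s, by rw [dupHead_cons, hyx]⟩
    obtain ⟨z, hz, hzx⟩ := hG.exists_adj_ne y x
    refine absurd ?_ (h (z ::ᵥ x ::ᵥ s) (suffixAdj_cons.2 ⟨hz, rfl⟩))
    rw [carryAdj_cons, carry_cons_of_ne hyx hzx.symm]
    exact ⟨hz, rfl⟩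

theorem carryAdj_dupHead (a b : List.Vector V (n + 1)) :
    CarryAdj G (dupHead a) (dupHead b) ↔ CarryAdj G a b := by
  obtain ⟨x, s, rfl⟩ := a.exists_eq_cons
  obtain ⟨y, t, rfl⟩ := b.exists_eq_cons
  rw [dupHead_cons, dupHead_cons, carryAdj_cons, carryAdj_cons, carry_cons_left,
    List.Vector.eq_cons_iff]
  simp

/-- The path is x x s, y x s, x y s, y y s. Its middle edge is a carry that is not a suffix edge,
which forces the letter x to be exchanged with y. -/
theorem suffixAdj_iff_dupHead (a b : List.Vector V (n + 1)) :
    SuffixAdj G a b ↔ ∃ p q, SuffixAdj G (dupHead a) p ∧ CarryAdj G p q ∧ ¬ SuffixAdj G p q ∧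
      SuffixAdj G q (dupHead b) := by
  obtain ⟨x, s, rfl⟩ := a.exists_eq_cons
  obtain ⟨w, t, rfl⟩ := b.exists_eq_cons
  simp only [dupHead_cons]
  constructor
  · rw [suffixAdj_cons]
    rintro ⟨hxw, rfl⟩
    refine ⟨w ::ᵥ x ::ᵥ s, x ::ᵥ w ::ᵥ s, suffixAdj_cons.2 ⟨hxw, rfl⟩, ?_, ?_,
      suffixAdj_cons.2 ⟨hxw, rfl⟩⟩
    · rw [carryAdj_cons, carry_cons_right _ _ hxw.ne]
      exact ⟨hxw.symm, rfl⟩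
    · rw [suffixAdj_cons]
      exact fun h => hxw.ne (congrArg List.Vector.head h.2)
  · rintro ⟨p, q, h1, h2, h3, h4⟩
    obtain ⟨y, p, rfl⟩ := p.exists_eq_cons
    obtain ⟨z, q, rfl⟩ := q.exists_eq_cons
    rw [suffixAdj_cons] at h1 h3 h4
    rw [carryAdj_cons] at h2
    obtain ⟨hxy, rfl⟩ := h1
    obtain ⟨hyz, rfl⟩ := h2
    obtain ⟨hzw, h⟩ := h4
    by_cases hxz : x = z
    · subst hxz
      rw [carry_cons_right _ _ hxy.ne, List.Vector.eq_cons_iff] at h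
      simp only [List.Vector.head_cons, List.Vector.tail_cons] at h
      rw [suffixAdj_cons]
      exact ⟨h.1 ▸ hxy, h.2⟩
    · exact absurd ⟨hyz, (carry_cons_of_ne hxy.ne hxz s).symm⟩ h3

/-- A permutation of words that preserves both kinds of adjacency and fixes every word whose first
two letters are equal is the identity. -/
theorem eq_of_fixes_dupHead (hG : G.TwoRegular) (hc : G.Preconnected)
    (f : Equiv.Perm (List.Vector V (n + 2)))
    (hA : ∀ a b, SuffixAdj G (f a) (f b) ↔ SuffixAdj G a b)
    (hB : ∀ a b, CarryAdj G (f a) (f b) ↔ CarryAdj G a b)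
    (hf : ∀ w, f (dupHead w) = dupHead w) (a : List.Vector V (n + 2)) : f a = a := by
  obtain ⟨v, a, rfl⟩ := a.exists_eq_cons
  obtain ⟨x, s, rfl⟩ := a.exists_eq_cons
  have hx : f (x ::ᵥ x ::ᵥ s) = x ::ᵥ x ::ᵥ s := hf (x ::ᵥ s)
  obtain ⟨y, hxy, -⟩ := hG.exists_adj_ne x x
  -- The word y x s is the second vertex of the path x x s, y x s, x y s, y y s. Both ends are
  -- fixed, and the kinds of its edges leave no other choice for the image.
  have hy : f (y ::ᵥ x ::ᵥ s) = y ::ᵥ x ::ᵥ s := by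
    have h1 : SuffixAdj G (x ::ᵥ x ::ᵥ s) (f (y ::ᵥ x ::ᵥ s)) := by
      rw [← hx, hA]
      exact suffixAdj_cons.2 ⟨hxy, rfl⟩
    have h2 : CarryAdj G (f (y ::ᵥ x ::ᵥ s)) (f (x ::ᵥ y ::ᵥ s)) := by
      rw [hB, carryAdj_cons, carry_cons_right _ _ hxy.ne]
      exact ⟨hxy.symm, rfl⟩
    have h3 : SuffixAdj G (f (x ::ᵥ y ::ᵥ s)) (y ::ᵥ y ::ᵥ s) := by
      rw [show y ::ᵥ y ::ᵥ s = f (y ::ᵥ y ::ᵥ s) from (hf (y ::ᵥ s)).symm, hA]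
      exact suffixAdj_cons.2 ⟨hxy, rfl⟩
    generalize f (y ::ᵥ x ::ᵥ s) = p at *
    generalize f (x ::ᵥ y ::ᵥ s) = q at *
    obtain ⟨z, p, rfl⟩ := p.exists_eq_cons
    obtain ⟨u, q, rfl⟩ := q.exists_eq_cons
    rw [suffixAdj_cons] at h1 h3
    rw [carryAdj_cons] at h2
    obtain ⟨hxz, rfl⟩ := h1
    obtain ⟨huy, rfl⟩ := h3
    by_cases hxu : x = u
    · subst hxu
      rw [carry_cons_right _ _ hxz.ne] at h2
      rw [show z = y from (congrArg List.Vector.head h2.2).symm]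
    · rw [carry_cons_of_ne hxz.ne hxu] at h2
      exact absurd (congrArg List.Vector.head h2.2).symm hxy.ne
  -- The fixed pair x, y spreads around the cycle of words with suffix x s: if b and its neighbor c
  -- are fixed, the other neighbor d can only go to c or d, and c is already taken.
  refine hc.mem_of_propagates (S := {v | f (v ::ᵥ x ::ᵥ s) = v ::ᵥ x ::ᵥ s}) ?_ hx hy hxy v
  intro b c d hb hc hbc hbd
  change f _ = _ at hb
  change f _ = _ at hc
  change f _ = _
  by_cases hdc : d = c
  · rw [hdc, hc]
  have h : SuffixAdj G (b ::ᵥ x ::ᵥ s) (f (d ::ᵥ x ::ᵥ s)) := by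
    rw [← hb, hA]
    exact suffixAdj_cons.2 ⟨hbd, rfl⟩
  obtain ⟨e, t, he⟩ := (f (d ::ᵥ x ::ᵥ s)).exists_eq_cons
  rw [he, suffixAdj_cons] at h
  obtain ⟨hbe, rfl⟩ := h
  rcases hG.eq_or_eq hbc hbd hbe (Ne.symm hdc) with rfl | rfl
  · exact absurd (congrArg List.Vector.head (f.injective (he.trans hc.symm))) hdc
  · exact he

/-- Every permutation of words that preserves both kinds of adjacency is induced letterwise by an
automorphism of the graph. -/
theorem exists_iso_of_preserves_adj (hG : G.TwoRegular) (hc : G.Preconnected)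
    (f : Equiv.Perm (List.Vector V (n + 1)))
    (hA : ∀ a b, SuffixAdj G (f a) (f b) ↔ SuffixAdj G a b)
    (hB : ∀ a b, CarryAdj G (f a) (f b) ↔ CarryAdj G a b) :
    ∃ φ : G ≃g G, ∀ w, f w = w.map φ := by
  induction n with
  | zero => exact exists_iso_of_length_one f hA
  | succ n ih =>
    have hdup : ∀ h : Equiv.Perm (List.Vector V (n + 2)),
        (∀ a b, SuffixAdj G (h a) (h b) ↔ SuffixAdj G a b) →
        (∀ a b, CarryAdj G (h a) (h b) ↔ CarryAdj G a b) →
        ∀ w, ∃ w', dupHead w' = h (dupHead w) := by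
      intro h hA hB w
      rw [exists_dupHead_iff hG]
      intro b
      obtain ⟨b, rfl⟩ := h.surjective b
      rw [hA, hB]
      exact (exists_dupHead_iff hG _).1 ⟨w, rfl⟩ b
    have hAs : ∀ a b, SuffixAdj G (f.symm a) (f.symm b) ↔ SuffixAdj G a b := by
      intro a b
      rw [← hA, f.apply_symm_apply, f.apply_symm_apply]
    have hBs : ∀ a b, CarryAdj G (f.symm a) (f.symm b) ↔ CarryAdj G a b := by
      intro a b
      rw [← hB, f.apply_symm_apply, f.apply_symm_apply]
    choose g hg using hdup f hA hB
    choose g' hg' using hdup f.symm hAs hBs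
    let e : Equiv.Perm (List.Vector V (n + 1)) :=
      ⟨g, g', fun w => dupHead_injective (by rw [hg', hg, f.symm_apply_apply]),
        fun w => dupHead_injective (by rw [hg, hg', f.apply_symm_apply])⟩
    have he : ∀ w, dupHead (e w) = f (dupHead w) := hg
    obtain ⟨φ, hφ⟩ := ih e
      (by
        intro a b
        rw [suffixAdj_iff_dupHead a b, suffixAdj_iff_dupHead (e a) (e b), he, he]
        refine f.surjective.exists.trans (exists_congr fun p => ?_)
        refine f.surjective.exists.trans (exists_congr fun q => ?_)
        rw [hA, hA, hA, hB])
      (by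
        intro a b
        rw [← carryAdj_dupHead, he, he, hB, carryAdj_dupHead])
    refine ⟨φ, fun w => ?_⟩
    -- Dividing `f` by the letterwise map found for the shorter words leaves a permutation that
    -- fixes all doubled words.
    have hfix := eq_of_fixes_dupHead hG hc (f.trans (mapPerm φ (n + 2)).symm)
      (by
        intro a b
        rw [← suffixAdj_map φ, ← mapPerm_apply, ← mapPerm_apply]
        simp only [Equiv.trans_apply, Equiv.apply_symm_apply]
        exact hA a b)
      (by
        intro a b
        rw [← carryAdj_map φ, ← mapPerm_apply, ← mapPerm_apply]
        simp only [Equiv.trans_apply, Equiv.apply_symm_apply]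
        exact hB a b)
      (by
        intro w
        rw [Equiv.trans_apply, Equiv.symm_apply_eq, ← he, hφ, dupHead_map, mapPerm_apply]) w
    rwa [Equiv.trans_apply, Equiv.symm_apply_eq] at hfix

end Rigidity

/-! ### The Schreier graph in terms of the two adjacencies -/

section Schreier

variable {V : Type*} [DecidableEq V] {G : SimpleGraph V} {n : ℕ}

theorem act_none (o : EdgeOrientation G) (w : List V) : (graphAutomaton G o).act none w = w := by
  induction w with
  | nil => rfl
  | cons x w ih => simp [MealyAutomaton.act, graphAutomaton] at ih ⊢; exact ih

theorem act_some (o : EdgeOrientation G) (d : o.darts) (w : List.Vector V n) :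
    (graphAutomaton G o).act (some d) w.1 = (carry d.1.fst d.1.snd w).1 := by
  induction n with
  | zero => rw [w.eq_nil]; rfl
  | succ n ih =>
    obtain ⟨x, s, rfl⟩ := w.exists_eq_cons
    rw [carry_cons, List.Vector.cons_val, MealyAutomaton.act]
    by_cases h1 : x = d.1.fst
    · simp [graphAutomaton, h1]
      exact ih s
    · have := act_none o s.1
      by_cases h2 : x = d.1.snd
      · simp [graphAutomaton, h2, d.1.adj.ne.symm]
        exact this
      · simp [graphAutomaton, h1, h2]
        exact this

theorem gen_some_smul (o : EdgeOrientation G) (d : o.darts) (w : List.Vector V n) :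
    (graphAutomaton G o).gen (graphAutomaton_invertible G o) (some d) • w =
      carry d.1.fst d.1.snd w :=
  Subtype.ext (act_some o d w)

theorem gen_none_smul (o : EdgeOrientation G) (w : List.Vector V n) :
    (graphAutomaton G o).gen (graphAutomaton_invertible G o) none • w = w :=
  Subtype.ext (act_none o w.1)

/-- The Schreier graph does not depend on the orientation of the edges. -/
theorem graphSchreier_adj_iff (o : EdgeOrientation G) (a b : List.Vector V n) :
    (graphSchreier G o n).Adj a b ↔ a ≠ b ∧ ∃ x y, G.Adj x y ∧ carry x y a = b := by
  refine and_congr_right fun hab => ?_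
  rw [Set.exists_range_iff]
  constructor
  · rintro ⟨_ | d, h | h⟩
    · exact absurd ((gen_none_smul o a).symm.trans h) hab
    · exact absurd ((gen_none_smul o b).symm.trans (inv_smul_eq_iff.1 h).symm).symm hab
    · exact ⟨_, _, d.1.adj, (gen_some_smul o d a).symm.trans h⟩
    · refine ⟨_, _, d.1.adj.symm, ?_⟩
      rw [inv_smul_eq_iff, gen_some_smul] at h
      rw [h, carry_carry d.1.adj.ne]
  · rintro ⟨x, y, hxy, rfl⟩
    let d : G.Dart := ⟨(x, y), hxy⟩
    rcases (o.exactly_one d).or with h | h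
    · exact ⟨some ⟨d, h⟩, Or.inl (gen_some_smul o ⟨d, h⟩ a)⟩
    · refine ⟨some ⟨d.symm, h⟩, Or.inr ?_⟩
      rw [inv_smul_eq_iff, gen_some_smul]
      exact (carry_carry hxy.ne a).symm

theorem graphSchreier_adj_iff_or (o : EdgeOrientation G) (a b : List.Vector V (n + 1)) :
    (graphSchreier G o (n + 1)).Adj a b ↔ SuffixAdj G a b ∨ CarryAdj G a b := by
  rw [graphSchreier_adj_iff]
  obtain ⟨u, s, rfl⟩ := a.exists_eq_cons
  constructor
  · rintro ⟨hne, x, y, hxy, rfl⟩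
    by_cases hux : u = x
    · subst hux
      rw [carry_cons_left]
      exact Or.inr (carryAdj_cons.2 ⟨hxy, rfl⟩)
    by_cases huy : u = y
    · subst huy
      rw [carry_cons_right _ _ hux]
      exact Or.inl (suffixAdj_cons.2 ⟨hxy.symm, rfl⟩)
    · exact absurd (carry_cons_of_ne hux huy s).symm hne
  · obtain ⟨v, t, rfl⟩ := b.exists_eq_cons
    rw [suffixAdj_cons, carryAdj_cons]
    rintro (⟨h, rfl⟩ | ⟨h, rfl⟩)
    · exact ⟨fun he => h.ne (congrArg List.Vector.head he), v, u, h.symm,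
        carry_cons_right _ _ h.ne s⟩
    · exact ⟨fun he => h.ne (congrArg List.Vector.head he), u, v, h, carry_cons_left _ _ s⟩

/-- In the Schreier graph, the words whose first two letters are equal are those of degree four;
all the other words have a smaller degree. -/
theorem exists_dupHead_iff_encard (hG : G.TwoRegular) (o : EdgeOrientation G)
    (a : List.Vector V (n + 2)) :
    (∃ w, dupHead w = a) ↔ 3 < ((graphSchreier G o (n + 2)).neighborSet a).encard := by
  obtain ⟨y, a, rfl⟩ := a.exists_eq_cons
  obtain ⟨x, s, rfl⟩ := a.exists_eq_cons
  obtain ⟨p, q, hpq, h⟩ := hG y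
  constructor
  · rintro ⟨w, hw⟩
    obtain ⟨z, t, rfl⟩ := w.exists_eq_cons
    rw [dupHead_cons] at hw
    obtain rfl : z = y := congrArg List.Vector.head hw
    obtain rfl : z = x := congrArg (fun v => v.tail.head) hw
    have hp := (h p).2 (Or.inl rfl)
    have hq := (h q).2 (Or.inr rfl)
    have hsub : ({p ::ᵥ z ::ᵥ s, q ::ᵥ z ::ᵥ s, p ::ᵥ p ::ᵥ carry z p s,
        q ::ᵥ q ::ᵥ carry z q s} : Set (List.Vector V (n + 2))) ⊆
          (graphSchreier G o (n + 2)).neighborSet (z ::ᵥ z ::ᵥ s) := by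
      rintro v (rfl | rfl | rfl | rfl) <;>
        rw [SimpleGraph.mem_neighborSet, graphSchreier_adj_iff_or, suffixAdj_cons,
          carryAdj_cons, carry_cons_left]
      · exact Or.inl ⟨hp, rfl⟩
      · exact Or.inl ⟨hq, rfl⟩
      · exact Or.inr ⟨hp, rfl⟩
      · exact Or.inr ⟨hq, rfl⟩
    refine lt_of_lt_of_le ?_ (Set.encard_le_encard hsub)
    rw [Set.encard_insert_of_notMem, Set.encard_insert_of_notMem, Set.encard_pair]
    · norm_num
    · intro he
      exact hpq (congrArg List.Vector.head he)
    · rintro (he | he)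
      · exact hpq (congrArg List.Vector.head he).symm
      · exact hq.ne (congrArg (fun v => v.tail.head) he)
    · rintro (he | he | he)
      · exact hpq (congrArg List.Vector.head he)
      · exact hp.ne (congrArg (fun v => v.tail.head) he)
      · exact hpq (congrArg List.Vector.head he)
  · intro hlt
    by_contra hne
    have hyx : x ≠ y := by
      rintro rfl
      exact hne ⟨x ::ᵥ s, rfl⟩
    refine absurd hlt (not_lt.2 ?_)
    -- Besides the two suffix neighbors, only the carry that exchanges the first two letters can
    -- give a new word.
    have hsub : (graphSchreier G o (n + 2)).neighborSet (y ::ᵥ x ::ᵥ s) ⊆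
        {p ::ᵥ x ::ᵥ s, q ::ᵥ x ::ᵥ s, x ::ᵥ y ::ᵥ s} := by
      intro v
      obtain ⟨z, t, rfl⟩ := v.exists_eq_cons
      rw [SimpleGraph.mem_neighborSet, graphSchreier_adj_iff_or, suffixAdj_cons, carryAdj_cons, h]
      by_cases hxz : x = z
      · subst hxz
        rw [carry_cons_right _ _ hyx]
        rintro (⟨rfl | rfl, rfl⟩ | ⟨-, rfl⟩) <;> simp
      · rw [carry_cons_of_ne hyx hxz]
        rintro (⟨rfl | rfl, rfl⟩ | ⟨rfl | rfl, rfl⟩) <;> simp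
    refine (Set.encard_le_encard hsub).trans ?_
    refine (Set.encard_insert_le _ _).trans ?_
    refine (add_le_add_left (Set.encard_insert_le _ _) 1).trans ?_
    rw [Set.encard_singleton]
    norm_num

end Schreier

/-! ### The cycle graph and its dihedral symmetry -/

section Cycle

open SimpleGraph
open scoped Fin.CommRing

theorem cycleGraph_twoRegular (m : ℕ) : (cycleGraph (m + 3)).TwoRegular := by
  intro x
  refine ⟨x - 1, x + 1, ?_, fun z => ?_⟩
  · intro h
    have h2 : (1 + 1 : Fin (m + 3)) = 0 := by linear_combination (-1 : Fin (m + 3)) * h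
    simp [Fin.ext_iff, Fin.val_add, Nat.mod_eq_of_lt] at h2
  · rw [← mem_neighborSet, cycleGraph_neighborSet]
    rfl

theorem cycleGraph_adj_add_one (m : ℕ) (x : Fin (m + 3)) :
    (cycleGraph (m + 3)).Adj x (x + 1) := by
  simp [cycleGraph_adj]

/-- The action of the dihedral group on the vertices of the cycle graph. -/
def dihedralPerm (m : ℕ) : DihedralGroup (m + 3) → Equiv.Perm (Fin (m + 3))
  | .r i => Equiv.addRight (show Fin (m + 3) from i)
  | .sr i => (Equiv.addRight (show Fin (m + 3) from i)).trans (Equiv.neg _)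

@[simp] theorem dihedralPerm_r (m : ℕ) (i : ZMod (m + 3)) (x : Fin (m + 3)) :
    dihedralPerm m (.r i) x = x + (show Fin (m + 3) from i) := rfl

@[simp] theorem dihedralPerm_sr (m : ℕ) (i : ZMod (m + 3)) (x : Fin (m + 3)) :
    dihedralPerm m (.sr i) x = -(x + (show Fin (m + 3) from i)) := rfl

/-- An element of the dihedral group, as an automorphism of the cycle graph. -/
def dihedralIso (m : ℕ) (d : DihedralGroup (m + 3)) :
    cycleGraph (m + 3) ≃g cycleGraph (m + 3) where
  toEquiv := dihedralPerm m d
  map_rel_iff' := by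
    intro x y
    rw [cycleGraph_adj, cycleGraph_adj]
    rcases d with (i : Fin (m + 3)) | (i : Fin (m + 3))
    · change x + i - (y + i) = 1 ∨ y + i - (x + i) = 1 ↔ _
      rw [add_sub_add_right_eq_sub, add_sub_add_right_eq_sub]
    · change -(x + i) - -(y + i) = 1 ∨ -(y + i) - -(x + i) = 1 ↔ _
      rw [neg_sub_neg, neg_sub_neg, add_sub_add_right_eq_sub, add_sub_add_right_eq_sub, or_comm]

/-- The automorphisms of the cycle graph, as a representation of the dihedral group. -/
def dihedralHom (m : ℕ) : DihedralGroup (m + 3) →* (cycleGraph (m + 3) ≃g cycleGraph (m + 3)) where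
  toFun := dihedralIso m
  map_one' := by
    ext x
    exact congrArg Fin.val (add_zero x)
  map_mul' := by
    intro a b
    apply RelIso.ext
    intro x
    rcases a with (i : Fin (m + 3)) | (i : Fin (m + 3)) <;>
      rcases b with (j : Fin (m + 3)) | (j : Fin (m + 3))
    · exact show x + (i + j) = x + j + i by ring
    · exact show -(x + (j - i)) = -(x + j) + i by ring
    · exact show -(x + (i + j)) = -(x + j + i) by ring
    · exact show x + (j - i) = -(-(x + j) + i) by ring

theorem dihedralHom_bijective (m : ℕ) : Function.Bijective (dihedralHom m) := by
  have hone : (1 + 1 : Fin (m + 3)) ≠ 0 := by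
    simp [Fin.ext_iff, Fin.val_add, Nat.mod_eq_of_lt]
  constructor
  · rw [injective_iff_map_eq_one]
    intro d hd
    have h0 : dihedralPerm m d 0 = 0 := DFunLike.congr_fun hd (0 : Fin (m + 3))
    have h1 : dihedralPerm m d 1 = 1 := DFunLike.congr_fun hd (1 : Fin (m + 3))
    rcases d with i | i
    · rw [dihedralPerm_r, zero_add] at h0
      exact congrArg DihedralGroup.r h0
    · rw [dihedralPerm_sr] at h0 h1
      exact absurd (by linear_combination h0 - h1) hone
  · intro φ
    -- Two automorphisms that agree on the adjacent vertices 0 and 1 are equal.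
    suffices h : ∃ d, dihedralPerm m d 0 = φ 0 ∧ dihedralPerm m d 1 = φ 1 by
      obtain ⟨d, h0, h1⟩ := h
      refine ⟨d, ?_⟩
      have h : ∀ v, ((dihedralIso m d).symm (φ v)) = v :=
        (cycleGraph_twoRegular m).eq_of_fixes_adj cycleGraph_preconnected
          (f := fun v => (dihedralIso m d).symm (φ v))
          ((dihedralIso m d).symm.injective.comp φ.injective)
          (fun x y hxy => by
            rwa [(dihedralIso m d).symm.map_adj_iff, φ.map_adj_iff])
          ((dihedralIso m d).injective (by
            change (dihedralIso m d) _ = _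
            rw [RelIso.apply_symm_apply]; exact h0.symm))
          ((dihedralIso m d).injective (by
            change (dihedralIso m d) _ = _
            rw [RelIso.apply_symm_apply]; exact h1.symm))
          (cycleGraph_adj_add_one m 0)
      apply RelIso.ext
      intro v
      have := congrArg (dihedralIso m d) (h v)
      rw [RelIso.apply_symm_apply] at this
      exact this.symm
    have h := φ.map_adj_iff.2 (cycleGraph_adj_add_one m 0)
    rw [cycleGraph_adj, zero_add] at h
    -- A descending step from φ 0 to φ 1 calls for a reflection, an ascending one for a rotation.
    rcases h with h | h
    · refine ⟨.sr (show Fin (m + 3) from -φ 0), ?_, ?_⟩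
      · exact show -(0 + -φ 0) = φ 0 by ring
      · exact show -(1 + -φ 0) = φ 1 by linear_combination h
    · refine ⟨.r (show Fin (m + 3) from φ 0), ?_, ?_⟩
      · exact show 0 + φ 0 = φ 0 by ring
      · exact show 1 + φ 0 = φ 1 by linear_combination -h

end Cycle

/-! ### Recovering the two kinds of edges from the bare graph -/

section Schreier

variable {V : Type*} [DecidableEq V] {G : SimpleGraph V} {n : ℕ}

/-- In terms of the Schreier graph and of the words whose first two letters are equal, the edges
that are not of the form `x w — y w`. -/
theorem carryAdj_and_not_suffixAdj_iff (o : EdgeOrientation G) (a b : List.Vector V (n + 2)) :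
    CarryAdj G a b ∧ ¬ SuffixAdj G a b ↔ (graphSchreier G o (n + 2)).Adj a b ∧
      (((∃ w, dupHead w = a) ∧ ∃ w, dupHead w = b) ∨
        ((¬ ∃ w, dupHead w = a) ∧ (¬ ∃ w, dupHead w = b) ∧
          ∃ c d, dupHead c ≠ dupHead d ∧ (graphSchreier G o (n + 2)).Adj a (dupHead c) ∧
            (graphSchreier G o (n + 2)).Adj b (dupHead d))) := by
  obtain ⟨y, a, rfl⟩ := a.exists_eq_cons
  obtain ⟨x, s, rfl⟩ := a.exists_eq_cons
  obtain ⟨z, b, rfl⟩ := b.exists_eq_cons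
  obtain ⟨u, t, rfl⟩ := b.exists_eq_cons
  -- The only doubled word that a non-doubled word can be adjacent to is the one in its own cycle.
  -- Distinct doubled neighbors thus certify distinct suffixes.
  have hnbr : ∀ (y x : V) (s : List.Vector V n) (c : List.Vector V (n + 1)), x ≠ y →
      (graphSchreier G o (n + 2)).Adj (y ::ᵥ x ::ᵥ s) (dupHead c) → c = x ::ᵥ s := by
    intro y x s c hxy h
    obtain ⟨v, r, rfl⟩ := c.exists_eq_cons
    rw [graphSchreier_adj_iff_or, dupHead_cons, suffixAdj_cons, carryAdj_cons] at h
    rcases h with ⟨-, h⟩ | ⟨hyv, h⟩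
    · exact h.symm
    · by_cases hxv : x = v
      · subst hxv
        rw [carry_cons_right _ _ hxy] at h
        exact absurd (congrArg List.Vector.head h) hxy
      · rw [carry_cons_of_ne hxy hxv] at h
        exact absurd (congrArg List.Vector.head h).symm hxv
  rw [exists_dupHead_cons_iff, exists_dupHead_cons_iff, graphSchreier_adj_iff_or,
    suffixAdj_cons, carryAdj_cons]
  constructor
  · rintro ⟨⟨hyz, h⟩, hne⟩
    refine ⟨Or.inr ⟨hyz, h⟩, ?_⟩
    by_cases hxy : x = y
    · subst hxy
      rw [carry_cons_left] at h
      exact Or.inl ⟨rfl, congrArg List.Vector.head h⟩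
    · by_cases hxz : x = z
      · subst hxz
        rw [carry_cons_right _ _ hxy] at h
        rw [h]
        refine Or.inr ⟨hxy, ?_, x ::ᵥ s, y ::ᵥ s, ?_, ?_, ?_⟩
        · rw [show u = y from congrArg List.Vector.head h]
          exact Ne.symm hxy
        · exact fun he => hxy (congrArg List.Vector.head he)
        · rw [graphSchreier_adj_iff_or, dupHead_cons, suffixAdj_cons]
          exact Or.inl ⟨hyz, rfl⟩
        · rw [graphSchreier_adj_iff_or, dupHead_cons, suffixAdj_cons]
          exact Or.inl ⟨hyz.symm, rfl⟩
      · rw [carry_cons_of_ne hxy hxz] at h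
        exact absurd ⟨hyz, h.symm⟩ hne
  · rintro ⟨hadj, h⟩
    have hS : ¬ (G.Adj y z ∧ x ::ᵥ s = u ::ᵥ t) := by
      rintro ⟨hyz, he⟩
      rcases h with ⟨rfl, rfl⟩ | ⟨hx, hu, c, d, hcd, hc, hd⟩
      · exact hyz.ne (congrArg List.Vector.head he)
      · rw [hnbr _ _ _ _ hx hc, hnbr _ _ _ _ hu hd] at hcd
        exact hcd (congrArg dupHead he)
    exact ⟨hadj.resolve_left hS, hS⟩

/-- A carry from y to z leaves x s unchanged exactly when x is neither y nor z, that is, when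
neither end is doubled. This expresses the double edges through adjacency, doubled words and the
pure carry edges. -/
theorem suffixAdj_and_carryAdj_iff (o : EdgeOrientation G) (a b : List.Vector V (n + 2)) :
    SuffixAdj G a b ∧ CarryAdj G a b ↔ (graphSchreier G o (n + 2)).Adj a b ∧
      (¬ ∃ w, dupHead w = a) ∧ (¬ ∃ w, dupHead w = b) ∧ ¬ (CarryAdj G a b ∧ ¬ SuffixAdj G a b) := by
  obtain ⟨y, a, rfl⟩ := a.exists_eq_cons
  obtain ⟨x, s, rfl⟩ := a.exists_eq_cons
  obtain ⟨z, b, rfl⟩ := b.exists_eq_cons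
  rw [graphSchreier_adj_iff_or]
  constructor
  · rintro ⟨hA, hB⟩
    refine ⟨Or.inl hA, ?_, ?_, fun h => h.2 hA⟩ <;> rw [suffixAdj_cons] at hA <;>
      obtain ⟨hyz, rfl⟩ := hA <;> rw [carryAdj_cons] at hB <;> rw [exists_dupHead_cons_iff] <;>
      rintro rfl
    · rw [carry_cons_left] at hB
      exact hyz.ne (congrArg List.Vector.head hB.2)
    · rw [carry_cons_right _ _ hyz.ne.symm] at hB
      exact hyz.ne (congrArg List.Vector.head hB.2).symm
  · rintro ⟨h, hy, hz, hn⟩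
    have hA : SuffixAdj G (y ::ᵥ x ::ᵥ s) (z ::ᵥ b) := by
      by_contra hA
      exact hn ⟨h.resolve_left hA, hA⟩
    refine ⟨hA, ?_⟩
    rw [suffixAdj_cons] at hA
    obtain ⟨hyz, rfl⟩ := hA
    rw [exists_dupHead_cons_iff] at hy hz
    rw [carryAdj_cons, carry_cons_of_ne hy hz]
    exact ⟨hyz, rfl⟩

theorem carryAdj_iff_suffixAdj_of_length_one (a b : List.Vector V 1) :
    CarryAdj G a b ↔ SuffixAdj G a b := by
  obtain ⟨x, s, rfl⟩ := a.exists_eq_cons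
  obtain ⟨y, t, rfl⟩ := b.exists_eq_cons
  rw [suffixAdj_cons, carryAdj_cons, s.eq_nil, t.eq_nil]
  exact and_congr_right fun _ => ⟨fun _ => rfl, fun _ => rfl⟩

/-- An automorphism of the Schreier graph preserves both kinds of edges. -/
theorem preserves_adj_of_iso (hG : G.TwoRegular) (o : EdgeOrientation G)
    (f : graphSchreier G o (n + 1) ≃g graphSchreier G o (n + 1)) (a b : List.Vector V (n + 1)) :
    (SuffixAdj G (f a) (f b) ↔ SuffixAdj G a b) ∧ (CarryAdj G (f a) (f b) ↔ CarryAdj G a b) := by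
  have hadj := f.map_adj_iff (v := a) (w := b)
  cases n with
  | zero =>
    rw [graphSchreier_adj_iff_or, graphSchreier_adj_iff_or, carryAdj_iff_suffixAdj_of_length_one,
      carryAdj_iff_suffixAdj_of_length_one, or_self, or_self] at hadj
    rw [carryAdj_iff_suffixAdj_of_length_one, carryAdj_iff_suffixAdj_of_length_one]
    exact ⟨hadj, hadj⟩
  | succ n =>
    have hdup : ∀ a, (∃ w, dupHead w = f a) ↔ ∃ w, dupHead w = a := by
      intro a
      rw [exists_dupHead_iff_encard hG o, exists_dupHead_iff_encard hG o,
        Set.encard_congr (f.mapNeighborSet a)]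
    have hdist : ∀ (f : graphSchreier G o (n + 2) ≃g graphSchreier G o (n + 2))
        (_ : ∀ a, (∃ w, dupHead w = f a) ↔ ∃ w, dupHead w = a) (a b),
        CarryAdj G a b ∧ ¬ SuffixAdj G a b → CarryAdj G (f a) (f b) ∧ ¬ SuffixAdj G (f a) (f b) := by
      intro f hdup a b
      rw [carryAdj_and_not_suffixAdj_iff o, carryAdj_and_not_suffixAdj_iff o, hdup, hdup,
        f.map_adj_iff]
      rintro ⟨h, h' | ⟨ha, hb, c, d, hcd, hc, hd⟩⟩
      · exact ⟨h, Or.inl h'⟩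
      · obtain ⟨c', hc'⟩ := (hdup (dupHead c)).2 ⟨c, rfl⟩
        obtain ⟨d', hd'⟩ := (hdup (dupHead d)).2 ⟨d, rfl⟩
        refine ⟨h, Or.inr ⟨ha, hb, c', d', ?_, ?_, ?_⟩⟩
        · rw [hc', hd']
          exact f.injective.ne hcd
        · rwa [hc', f.map_adj_iff]
        · rwa [hd', f.map_adj_iff]
    have hBA : CarryAdj G (f a) (f b) ∧ ¬ SuffixAdj G (f a) (f b) ↔
        CarryAdj G a b ∧ ¬ SuffixAdj G a b := by
      refine ⟨fun h => ?_, hdist f hdup a b⟩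
      have := hdist f.symm (fun a => by rw [← hdup, f.apply_symm_apply]) _ _ h
      rwa [f.symm_apply_apply, f.symm_apply_apply] at this
    have hAB : SuffixAdj G (f a) (f b) ∧ CarryAdj G (f a) (f b) ↔
        SuffixAdj G a b ∧ CarryAdj G a b := by
      rw [suffixAdj_and_carryAdj_iff o, suffixAdj_and_carryAdj_iff o, hBA, hdup, hdup, hadj]
    -- Pure carry edges, edges of both kinds and all edges are preserved; hence so are the pure
    -- suffix edges.
    rw [graphSchreier_adj_iff_or, graphSchreier_adj_iff_or] at hadj
    tauto

/-- The automorphism of the Schreier graph that an automorphism of the graph induces letterwise. -/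
def letterwiseIso (o : EdgeOrientation G) (φ : G ≃g G) :
    graphSchreier G o (n + 1) ≃g graphSchreier G o (n + 1) where
  toEquiv := mapPerm φ (n + 1)
  map_rel_iff' := by
    intro a b
    rw [graphSchreier_adj_iff_or, graphSchreier_adj_iff_or, mapPerm_apply, mapPerm_apply,
      suffixAdj_map, carryAdj_map]

/-- The letterwise action of the automorphisms of the graph on the Schreier graph. -/
def letterwiseHom (o : EdgeOrientation G) (n : ℕ) :
    (G ≃g G) →* (graphSchreier G o (n + 1) ≃g graphSchreier G o (n + 1)) where
  toFun := letterwiseIso o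
  map_one' := RelIso.ext fun w => List.Vector.map_id w
  map_mul' φ ψ := RelIso.ext fun w => by
    change w.map (fun x => φ (ψ x)) = (w.map ψ).map φ
    ext i
    simp

theorem letterwiseHom_apply (o : EdgeOrientation G) (φ : G ≃g G) (w : List.Vector V (n + 1)) :
    letterwiseHom o n φ w = w.map φ := rfl

theorem letterwiseHom_bijective (hG : G.TwoRegular) (hc : G.Preconnected) (o : EdgeOrientation G) :
    Function.Bijective (letterwiseHom o n) := by
  constructor
  · intro φ ψ h
    apply RelIso.ext
    intro x
    -- Constant words recover the automorphism; a first letter exists because the length is `n + 1`.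
    have h := DFunLike.congr_fun h (List.Vector.replicate (n + 1) x)
    rw [letterwiseHom_apply, letterwiseHom_apply] at h
    exact congrArg List.Vector.head h
  · intro f
    obtain ⟨φ, hφ⟩ := exists_iso_of_preserves_adj hG hc f.toEquiv
      (fun a b => (preserves_adj_of_iso hG o f a b).1)
      (fun a b => (preserves_adj_of_iso hG o f a b).2)
    exact ⟨φ, RelIso.ext fun w => (hφ w).symm⟩

end Schreier

theorem theorem4p8 (k n : ℕ) (hk : 3 ≤ k) (hn : 1 ≤ n)
    (o : EdgeOrientation (SimpleGraph.cycleGraph k)) :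
    (∃ Φ : (SimpleGraph.cycleGraph k ≃g SimpleGraph.cycleGraph k) ≃*
          (graphSchreier (SimpleGraph.cycleGraph k) o n ≃g
            graphSchreier (SimpleGraph.cycleGraph k) o n),
        ∀ (φ : SimpleGraph.cycleGraph k ≃g SimpleGraph.cycleGraph k)
          (w : List.Vector (Fin k) n), Φ φ w = List.Vector.map φ w) ∧
      Nonempty ((SimpleGraph.cycleGraph k ≃g SimpleGraph.cycleGraph k) ≃* DihedralGroup k) := by
  obtain ⟨m, rfl⟩ := Nat.exists_eq_add_of_le' hk
  obtain ⟨n, rfl⟩ := Nat.exists_eq_add_of_le' hn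
  exact ⟨⟨MulEquiv.ofBijective (letterwiseHom o n)
    (letterwiseHom_bijective (cycleGraph_twoRegular m) SimpleGraph.cycleGraph_preconnected o),
    letterwiseHom_apply o⟩,
    ⟨(MulEquiv.ofBijective (dihedralHom m) (dihedralHom_bijective m)).symm⟩⟩
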